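/- **Setting.** Let $B=\begin{pmatrix}0&-2&2\\2&0&-2\\-2&2&0\end{pmatrix}$, with rows and columns $1,2,3$ labelled $0,-1,\infty$ in this order. The Markov cluster algebra (with principal coefficients) is given by the initial seed whose cluster is $(x_1,x_2,x_3)$, whose coefficient variables are $x_4,x_5,x_6$, and whose $6\times3$ exchange matrix is $\tilde B_0=\binom{B}{I_3}$. Mutation $\mu_k$ of a seed $(\tilde B,\mathbf x)$ replaces $b_{ij}$ by $-b_{ij}$ if $i=k$ or $j=k$ and by $b_{ij}+\mathrm{sgn}(b_{ik})\max(b_{ik}b_{kj},0)$ otherwise, and replaces $x_k$ by $x_k^{-1}\bigl(\prod_{i=1}^{6}x_i^{\max(b_{ik},0)}+\prod_{i=1}^{6}x_i^{\max(-b_{ik},0)}\bigr)$, where $x_4,x_5,x_6$ stay fixed. Give $x_j$ the degree $\mathbf e_j\in\mathbb Z^3$ and $x_{3+j}$ the degree minus the $j$-th column of $B$, for $j=1,2,3$. The cluster variables of every seed reached from the initial one are homogeneous rational functions in the initial $x_1,\dots,x_6$; their degrees are the *g-vectors*, and the *g-matrix* of a seed has as columns the degrees of its three cluster variables, in order. For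 $q\in\mathbb Q\cup\{\infty\}$ write $q=d(q)/r(q)$ in lowest terms with $r(q)\ge0$ and $\infty=1/0$; $\infty$ is the largest element. A *Farey triple* is a set of three elements of $\mathbb Q\cup\{\infty\}$ with $|d(q)r(q')-d(q')r(q)|=1$ for any two of them; it is written $[q_0,q_{-1},q_\infty]$ in the order [even/odd, odd/odd, odd/even]. The mutation $\mu_k$, $k\in\{0,-1,\infty\}$, replaces $q_k$ by $\frac{d(p)-d(p')}{r(p)-r(p')}$ if $q_k$ lies between the two other components $p,p'$, and by $\frac{d(p)+d(p')}{r(p)+r(p')}$ otherwise. The graph $\mathbb T_3$ has the Farey triples as vertices and an edge labelled $k$ between $T$ and $\mu_k(T)$. Let $T_0=[\frac01,\frac{-1}1,\frac10]$ and let $\mathbb T_3^{i}$ be the connected component of $\mathbb T_3\setminus T_0$ that contains $\mu_i(T_0)$. Let $\phi:\mathbb T_3^{-1}\to\mathbb T_3^{\infty}$ be the graph isomorphism with $\phi(\mu_{-1}T_0)=\mu_\infty T_0$ that maps edges labelled $-1,0,\infty$ to edges labelled $\infty,-1,0$ respectively, and $\psi:\mathbb T_3^{-1}\to\mathbb T_3^{0}$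 the graph isomorphism with $\psi(\mu_{-1}T_0)=\mu_0T_0$ that maps edges labelled $-1,0,\infty$ to edges labelled $0,\infty,-1$ respectively. The g-matrix of the Farey triple $\mu_{a_m}\cdots\mu_{a_1}(T_0)$ is the g-matrix of the seed obtained from the initial seed by $\mu_{a_m}\cdots\mu_{a_1}$. For a permutation $\sigma$ of $\{1,2,3\}$ and a $3\times3$ matrix $M=(m_{ij})$, let $\sigma\cdot M$ be the matrix whose entry at $(\sigma(i),\sigma(j))$ is $m_{ij}$. **Proposition.** Every seed reached from the initial one has exactly one g-matrix, every Farey triple has exactly one g-matrix, and $\phi$ and $\psi$ exist and are unique. Let $T$ be a Farey triple in $\mathbb T_3^{-1}$ with g-matrix $M$. Then $\phi(T)$ has g-matrix $(123)\cdot M$ and $\psi(T)$ has g-matrix $(132)\cdot M$. The set of all g-vectors of the Markov cluster algebra is the set of the columns of the matrices $M$, $(123)\cdot M$ and $(132)\cdot M$, where $M$ runs over the g-matrices of the triples in $\mathbb T_3^{-1}$. Every g-vector $(x,y,z)$ satisfies $x+y+z=1$. -/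

import Mathlib

/-! ## Cluster patterns with principal coefficients

`ι` indexes the `n` mutable directions.  The rows of an extended exchange matrix and the variables
`x_1, …, x_{2n}` are indexed by `ι ⊕ ι`: `Sum.inl` for `1, …, n`, `Sum.inr` for `n+1, …, 2n`. -/

namespace ClusterPattern

/-- The ambient field `ℚ(x_1, …, x_{2n})`. -/
abbrev Ambient (ι : Type) : Type := FractionRing (MvPolynomial (ι ⊕ ι) ℚ)

/-- The variable `x_i` in the ambient field. -/
noncomputable def var {ι : Type} (i : ι ⊕ ι) : Ambient ι :=
  algebraMap (MvPolynomial (ι ⊕ ι) ℚ) (Ambient ι) (MvPolynomial.X i)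

/-- The data of a labelled seed: an extended exchange matrix and a cluster. Only the seeds obtained
from an initial seed by mutations are used below. -/
@[ext]
structure Seed (ι : Type) where
  mat : Matrix (ι ⊕ ι) ι ℤ
  cluster : ι → Ambient ι

variable {ι : Type} [Fintype ι] [DecidableEq ι]

/-- Matrix mutation in direction `k`. -/
def mutateMatrix (k : ι) (b : Matrix (ι ⊕ ι) ι ℤ) : Matrix (ι ⊕ ι) ι ℤ :=
  Matrix.of fun i j =>
    if i = Sum.inl k ∨ j = k then -b i j
    else b i j + (b i k).sign * max (b i k * b (Sum.inl k) j) 0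

/-- The cluster variables of a seed together with the frozen variables `x_{n+1}, …, x_{2n}`. -/
noncomputable def Seed.extended (s : Seed ι) : ι ⊕ ι → Ambient ι :=
  Sum.elim s.cluster fun j => var (Sum.inr j)

/-- Seed mutation in direction `k`; `Int.toNat` is the positive part `[·]_+`. -/
noncomputable def Seed.mutate (k : ι) (s : Seed ι) : Seed ι where
  mat := mutateMatrix k s.mat
  cluster := Function.update s.cluster k
    ((∏ i, s.extended i ^ (s.mat i k).toNat + ∏ i, s.extended i ^ (-s.mat i k).toNat)
      / s.cluster k)

/-- The initial seed with principal part `B` and principal coefficients. -/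
noncomputable def initialSeed (B : Matrix ι ι ℤ) : Seed ι where
  mat := Matrix.fromRows B 1
  cluster := fun j => var (Sum.inl j)

/-- The seed `μ_{a_m} ⋯ μ_{a_1}` of the initial seed, for the word `l = [a_1, …, a_m]`. The words are
the walks in the `n`-regular tree from its root. -/
noncomputable def seedAt (B : Matrix ι ι ℤ) (l : List ι) : Seed ι :=
  l.foldl (fun s k => s.mutate k) (initialSeed B)

/-- The `ℤⁿ`-grading: `x_j` has degree `e_j` and `x_{n+j}` has degree minus the `j`-th column
of `B`. -/
def weight (B : Matrix ι ι ℤ) : ι ⊕ ι → (ι → ℤ) :=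
  Sum.elim (fun j => Pi.single j 1) fun j i => -B i j

/-- The nonzero rational function `f` is homogeneous of degree `g`: it is a quotient `p / q` of
homogeneous polynomials with `deg p - deg q = g`. On Laurent polynomials this is homogeneity of
degree `g` for the grading `weight B`. -/
def HasDegree (B : Matrix ι ι ℤ) (f : Ambient ι) (g : ι → ℤ) : Prop :=
  ∃ (p q : MvPolynomial (ι ⊕ ι) ℚ) (a b : ι → ℤ), p ≠ 0 ∧ q ≠ 0 ∧
    MvPolynomial.IsWeightedHomogeneous (weight B) p a ∧
    MvPolynomial.IsWeightedHomogeneous (weight B) q b ∧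
    f = algebraMap _ (Ambient ι) p / algebraMap _ (Ambient ι) q ∧ g = a - b

/-- `M` is the g-matrix of the seed reached along `l`: its `j`-th column is the degree of the
`j`-th cluster variable. -/
def IsGMatrixAt (B : Matrix ι ι ℤ) (l : List ι) (M : Matrix ι ι ℤ) : Prop :=
  ∀ j, HasDegree B ((seedAt B l).cluster j) (fun i => M i j)

/-- The set of g-vectors: the degrees of all the cluster variables. -/
def gVectors (B : Matrix ι ι ℤ) : Set (ι → ℤ) :=
  {g | ∃ (l : List ι) (j : ι), HasDegree B ((seedAt B l).cluster j) g}

end ClusterPattern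

/-! ## Farey triples -/

namespace Farey

/-- The numerator `d(q)`, with `∞ = 1 / 0`. -/
def d : WithTop ℚ → ℤ
  | ⊤ => 1
  | (q : ℚ) => q.num

/-- The denominator `r(q) ≥ 0`, with `∞ = 1 / 0`. -/
def r : WithTop ℚ → ℤ
  | ⊤ => 0
  | (q : ℚ) => q.den

/-- The extended rational number `a / b`, for `a`, `b` not both zero. -/
def frac (a b : ℤ) : WithTop ℚ :=
  if b = 0 then ⊤ else (((a : ℚ) / (b : ℚ) : ℚ) : WithTop ℚ)

def Delta (p q : WithTop ℚ) : ℤ := |d p * r q - d q * r p|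

/-- Farey sum of Farey neighbours. -/
def add (p q : WithTop ℚ) : WithTop ℚ := frac (d p + d q) (r p + r q)

/-- Farey difference of Farey neighbours. -/
def diff (p q : WithTop ℚ) : WithTop ℚ := frac (d p - d q) (r p - r q)

theorem exists_sign_frac {a b : ℤ} (h : IsCoprime a b) :
    ∃ e : ℤ, (e = 1 ∨ e = -1) ∧ d (frac a b) = e * a ∧ r (frac a b) = e * b := by
  unfold frac
  split_ifs with hb
  · subst hb
    have ha : IsUnit a := isCoprime_zero_right.1 h
    rcases Int.isUnit_iff.1 ha with rfl | rfl
    · exact ⟨1, Or.inl rfl, by simp [d], by simp [r]⟩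
    · exact ⟨-1, Or.inr rfl, by simp [d], by simp [r]⟩
  · have hc : Nat.Coprime a.natAbs b.natAbs := Int.isCoprime_iff_gcd_eq_one.1 h
    rcases lt_or_gt_of_ne hb with hb | hb
    · refine ⟨-1, Or.inr rfl, ?_, ?_⟩
      · have := Rat.num_div_eq_of_coprime (a := -a) (b := -b) (by omega) (by simpa using hc)
        simpa [d, neg_div_neg_eq] using this
      · have := Rat.den_div_eq_of_coprime (a := -a) (b := -b) (by omega) (by simpa using hc)
        simpa [r, neg_div_neg_eq] using this
    · refine ⟨1, Or.inl rfl, ?_, ?_⟩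
      · simpa [d] using Rat.num_div_eq_of_coprime hb hc
      · simpa [r] using Rat.den_div_eq_of_coprime hb hc

/-- The parity class of a fraction: class `0` is even/odd, class `1` is odd/odd, class `2` is
odd/even. -/
def HasClass (q : WithTop ℚ) : Fin 3 → Prop
  | 0 => Even (d q) ∧ Odd (r q)
  | 1 => Odd (d q) ∧ Odd (r q)
  | 2 => Odd (d q) ∧ Even (r q)

/-- A Farey triple `[q_0, q_{-1}, q_∞]`: three pairwise Farey neighbours. A triple up to permutation
is represented by its unique ordering `[even/odd, odd/odd, odd/even]`, so that the labels
`0, -1, ∞` are the indices `0, 1, 2`. -/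
@[ext]
structure FareyTriple where
  q : Fin 3 → WithTop ℚ
  neighbors : ∀ i j, i ≠ j → Delta (q i) (q j) = 1
  parity : ∀ i, HasClass (q i) i

/-- The fraction that replaces `T.q k`: the Farey difference of the two others if `T.q k` lies
strictly between them, and their Farey sum otherwise. -/
def FareyTriple.newEntry (T : FareyTriple) (k : Fin 3) : WithTop ℚ :=
  if (T.q (k + 1) < T.q k ∧ T.q k < T.q (k + 2)) ∨ (T.q (k + 2) < T.q k ∧ T.q k < T.q (k + 1))
  then diff (T.q (k + 1)) (T.q (k + 2))
  else add (T.q (k + 1)) (T.q (k + 2))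

theorem Delta_comm (p q : WithTop ℚ) : Delta p q = Delta q p := by
  unfold Delta; rw [abs_sub_comm]

theorem FareyTriple.exists_newEntry (T : FareyTriple) (k : Fin 3) :
    ∃ e e' : ℤ, (e = 1 ∨ e = -1) ∧ (e' = 1 ∨ e' = -1) ∧
      d (T.newEntry k) = e * (d (T.q (k + 1)) + e' * d (T.q (k + 2))) ∧
      r (T.newEntry k) = e * (r (T.q (k + 1)) + e' * r (T.q (k + 2))) := by
  have hn : Delta (T.q (k + 1)) (T.q (k + 2)) = 1 := T.neighbors _ _ (by revert k; decide)
  have hc : ∀ e' : ℤ, IsCoprime (d (T.q (k + 1)) + e' * d (T.q (k + 2)))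
      (r (T.q (k + 1)) + e' * r (T.q (k + 2))) := by
    intro e'
    unfold Delta at hn
    rcases (abs_eq (by norm_num)).1 hn with h | h
    · exact ⟨r (T.q (k + 2)), -d (T.q (k + 2)), by linear_combination h⟩
    · exact ⟨-r (T.q (k + 2)), d (T.q (k + 2)), by linear_combination -h⟩
  unfold FareyTriple.newEntry
  split_ifs
  · obtain ⟨e, he, h1, h2⟩ := exists_sign_frac (hc (-1))
    refine ⟨e, -1, he, Or.inr rfl, ?_, ?_⟩
    · rw [← h1]; simp [diff, sub_eq_add_neg]
    · rw [← h2]; simp [diff, sub_eq_add_neg]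
  · obtain ⟨e, he, h1, h2⟩ := exists_sign_frac (hc 1)
    refine ⟨e, 1, he, Or.inl rfl, ?_, ?_⟩
    · rw [← h1]; simp [add]
    · rw [← h2]; simp [add]

theorem FareyTriple.newEntry_neighbors (T : FareyTriple) (k j : Fin 3) (hj : j ≠ k) :
    Delta (T.newEntry k) (T.q j) = 1 := by
  have hk : k + 1 ≠ k + 2 := by clear hj; revert k; decide
  have hn : Delta (T.q (k + 1)) (T.q (k + 2)) = 1 := T.neighbors _ _ hk
  have hj' : j = k + 1 ∨ j = k + 2 := by clear hk hn; revert j k; decide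
  obtain ⟨e, e', he, he', h1, h2⟩ := T.exists_newEntry k
  unfold Delta at hn ⊢
  rw [h1, h2, ← hn]
  rcases hj' with rfl | rfl <;> rcases he with rfl | rfl <;> rcases he' with rfl | rfl <;>
    rw [abs_eq_abs] <;> first | (left; ring1) | (right; ring1)

theorem FareyTriple.newEntry_hasClass (T : FareyTriple) (k : Fin 3) :
    HasClass (T.newEntry k) k := by
  obtain ⟨e, e', he, he', h1, h2⟩ := T.exists_newEntry k
  have h0 := T.parity 0
  have h3 := T.parity 1
  have h4 := T.parity 2
  have a1 : (0 + 1 : Fin 3) = 1 := rfl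
  have a2 : (0 + 2 : Fin 3) = 2 := rfl
  have a3 : (1 + 1 : Fin 3) = 2 := rfl
  have a4 : (1 + 2 : Fin 3) = 0 := rfl
  have a5 : (2 + 1 : Fin 3) = 0 := rfl
  have a6 : (2 + 2 : Fin 3) = 1 := rfl
  have hk : k = 0 ∨ k = 1 ∨ k = 2 := by clear h1 h2; revert k; decide
  simp only [HasClass, Int.even_iff, Int.odd_iff] at h0 h3 h4
  rcases hk with rfl | rfl | rfl <;> simp only [HasClass, Int.even_iff, Int.odd_iff] <;>
    rw [h1, h2] <;> simp only [a1, a2, a3, a4, a5, a6] <;>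
    rcases he with rfl | rfl <;> rcases he' with rfl | rfl <;> omega

/-- Mutation of Farey triples in the direction of the component with label `k`. -/
def FareyTriple.mutate (k : Fin 3) (T : FareyTriple) : FareyTriple where
  q := Function.update T.q k (T.newEntry k)
  neighbors := by
    intro i j hij
    by_cases hi : i = k
    · subst hi
      rw [Function.update_self, Function.update_of_ne hij.symm]
      exact T.newEntry_neighbors i j hij.symm
    · by_cases hj : j = k
      · subst hj
        rw [Function.update_self, Function.update_of_ne hij, Delta_comm]
        exact T.newEntry_neighbors j i hij
      · rw [Function.update_of_ne hi, Function.update_of_ne hj]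
        exact T.neighbors i j hij
  parity := by
    intro i
    by_cases hi : i = k
    · subst hi
      rw [Function.update_self]
      exact T.newEntry_hasClass i
    · rw [Function.update_of_ne hi]
      exact T.parity i

/-- The initial Farey triple `[0/1, -1/1, 1/0]`. -/
def initialTriple : FareyTriple where
  q := ![((0 : ℚ) : WithTop ℚ), ((-1 : ℚ) : WithTop ℚ), ⊤]
  neighbors := by
    intro i j hij
    fin_cases i <;> fin_cases j <;> first | exact absurd rfl hij | rfl
  parity := by
    intro i
    fin_cases i
    · exact ⟨⟨0, rfl⟩, ⟨0, rfl⟩⟩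
    · exact ⟨⟨-1, rfl⟩, ⟨0, rfl⟩⟩
    · exact ⟨⟨0, rfl⟩, ⟨0, rfl⟩⟩

/-- The exchange graph `𝕋₃` of the Farey triples. -/
def exchangeGraph : SimpleGraph FareyTriple :=
  SimpleGraph.fromRel fun S T => ∃ k, T = S.mutate k

theorem mutate_initialTriple_ne (k : Fin 3) : initialTriple.mutate k ≠ initialTriple := by
  intro h
  have h1 : initialTriple.newEntry k = initialTriple.q k := by
    have := congrFun (congrArg FareyTriple.q h) k
    simpa [FareyTriple.mutate] using this
  have hk : k = 0 ∨ k = 1 ∨ k = 2 := by clear h h1; revert k; decide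
  rcases hk with rfl | rfl | rfl
  · rw [FareyTriple.newEntry, if_pos (by decide)] at h1
    change frac (-2) 1 = ((0 : ℚ) : WithTop ℚ) at h1
    rw [frac, if_neg (by decide), WithTop.coe_inj] at h1
    norm_num at h1
  · rw [FareyTriple.newEntry, if_neg (by decide)] at h1
    change frac 1 1 = ((-1 : ℚ) : WithTop ℚ) at h1
    rw [frac, if_neg (by decide), WithTop.coe_inj] at h1
    norm_num at h1
  · rw [FareyTriple.newEntry, if_neg (by decide)] at h1
    change frac (-1) 2 = ⊤ at h1
    rw [frac, if_neg (by decide)] at h1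
    exact WithTop.coe_ne_top h1

/-- The graph `𝕋₃ ∖ [0/1, -1/1, 1/0]`. -/
abbrev puncturedGraph : SimpleGraph {T : FareyTriple // T ≠ initialTriple} :=
  exchangeGraph.induce {T | T ≠ initialTriple}

/-- The vertices of the connected component `𝕋₃ⁱ` of `𝕋₃ ∖ [0/1, -1/1, 1/0]` that contains the
mutation of the initial triple in direction `i`. -/
def component (i : Fin 3) : Set FareyTriple :=
  {T | ∃ h : T ≠ initialTriple,
    puncturedGraph.Reachable ⟨initialTriple.mutate i, mutate_initialTriple_ne i⟩ ⟨T, h⟩}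

/-- The mutation of the initial triple in direction `i`, as a vertex of `𝕋₃ⁱ`. -/
def base (i : Fin 3) : component i :=
  ⟨initialTriple.mutate i, mutate_initialTriple_ne i, SimpleGraph.Reachable.refl _⟩

/-- The graph isomorphism `f : 𝕋₃ⁱ → 𝕋₃ʲ` maps base vertex to base vertex, and edges with label `k`
to edges with label `σ k`. -/
def IsLabelledIso (σ : Equiv.Perm (Fin 3)) {i j : Fin 3}
    (f : exchangeGraph.induce (component i) ≃g exchangeGraph.induce (component j)) : Prop :=
  f (base i) = base j ∧
    ∀ (S T : component i) (k : Fin 3), T.1 = S.1.mutate k → (f T).1 = (f S).1.mutate (σ k)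

end Farey

/-! ## The Markov cluster algebra -/

namespace Markov

open Equiv.Perm ClusterPattern Farey

/-- The principal part of the initial exchange matrix; rows and columns are labelled `0, -1, ∞`. -/
def markovMatrix : Matrix (Fin 3) (Fin 3) ℤ := !![0, -2, 2; 2, 0, -2; -2, 2, 0]

/-- `M` is a g-matrix assigned to the Farey triple `T`: for some word `[a_1, …, a_m]`, `T` is
`μ_{a_m} ⋯ μ_{a_1}` of the initial triple and `M` is the g-matrix of the seed
`μ_{a_m} ⋯ μ_{a_1}` of the initial seed. -/
def IsGMatrixOf (T : FareyTriple) (M : Matrix (Fin 3) (Fin 3) ℤ) : Prop :=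
  ∃ l : List (Fin 3), T = l.foldl (fun S k => S.mutate k) initialTriple ∧
    IsGMatrixAt markovMatrix l M

/-- The action of permutations on matrices by simultaneous permutation of rows and columns: the
entry of `M` at `(i, j)` is moved to the place `(σ i, σ j)`. -/
def permAct (σ : Equiv.Perm (Fin 3)) (M : Matrix (Fin 3) (Fin 3) ℤ) :
    Matrix (Fin 3) (Fin 3) ℤ :=
  Matrix.reindex σ σ M

/-- The cycle `(1 2 3)`; the indices `1, 2, 3` are `0, 1, 2 : Fin 3`. -/
def cyc123 : Equiv.Perm (Fin 3) := c[0, 1, 2]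

/-- The cycle `(1 3 2)`. -/
def cyc132 : Equiv.Perm (Fin 3) := c[0, 2, 1]

end Markov

namespace ClusterPattern

variable {ι : Type}

/-! The proof separates degrees from rational functions. The grading makes both monomials of each
initial exchange relation equal in degree, and mutation preserves this (`GData.Balanced.mutate`), so
every cluster variable is homogeneous and its degree follows a mutation rule on integer data. Sums
of homogeneous fractions could cancel; positivity at the point $(1,\dots,1)$ excludes this. The rule
on degrees is an involution on balanced data.

Farey triples carry the positive definite form $d^2+dr+r^2$. By the parallelogram law and a parity
argument, mutation strictly raises or strictly lowers its value at the changed component. Exactly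
one direction descends from each triple other than $T_0$, and none from $T_0$. Hence $\mathbb T_3$
is a tree: words without repeated adjacent letters correspond bijectively to triples
(`tripleAt_surjective`, `tripleAt_injOn`). Words with the same triple thus differ by cancellations,
and the g-matrix depends on the triple alone.

Cyclic permutations preserve $B$, so relabelling a word permutes its g-matrix (`gData_map`).
Relabelling also gives an automorphism of the tree fixing $T_0$, whose restrictions are $\phi$ and
$\psi$. The three components and $T_0$ exhaust the triples, which yields all g-vectors. The
principal part remains $\pm B$, so a new degree has coordinate sum $2\cdot 1-1=1$. -/

theorem algebraMap_ambient_ne_zero {p : MvPolynomial (ι ⊕ ι) ℚ} (hp : p ≠ 0) :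
    algebraMap _ (Ambient ι) p ≠ 0 := by
  simpa using hp

theorem ne_zero_of_eval_pos {p : MvPolynomial (ι ⊕ ι) ℚ} (hp : 0 < MvPolynomial.eval 1 p) :
    p ≠ 0 := by
  rintro rfl
  simp at hp

variable [DecidableEq ι]

theorem mutateMatrix_mutateMatrix {k : ι} {b : Matrix (ι ⊕ ι) ι ℤ} :
    mutateMatrix k (mutateMatrix k b) = b := by
  ext i j
  by_cases h : i = Sum.inl k ∨ j = k
  · simp [mutateMatrix, h]
  · simp [mutateMatrix, h]

/-! ### Degrees of rational functions -/

/-- The rational function `f` is a quotient of homogeneous polynomials of degrees with difference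
`g` which are both positive at the point `(1, …, 1)`. In contrast to `HasDegree`, this is stable
under sums. -/
def HasPositiveDegree (B : Matrix ι ι ℤ) (f : Ambient ι) (g : ι → ℤ) : Prop :=
  ∃ (p q : MvPolynomial (ι ⊕ ι) ℚ) (a b : ι → ℤ),
    0 < MvPolynomial.eval 1 p ∧ 0 < MvPolynomial.eval 1 q ∧
    MvPolynomial.IsWeightedHomogeneous (weight B) p a ∧
    MvPolynomial.IsWeightedHomogeneous (weight B) q b ∧
    f = algebraMap _ (Ambient ι) p / algebraMap _ (Ambient ι) q ∧ g = a - b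

variable {B : Matrix ι ι ℤ}

theorem HasPositiveDegree.hasDegree {f : Ambient ι} {g : ι → ℤ} (h : HasPositiveDegree B f g) :
    HasDegree B f g := by
  obtain ⟨p, q, a, b, hp, hq, h⟩ := h
  exact ⟨p, q, a, b, ne_zero_of_eval_pos hp, ne_zero_of_eval_pos hq, h⟩

/-- After cross-multiplication both degrees are read off from one nonzero polynomial, which is
homogeneous of only one degree. -/
theorem HasDegree.unique {f : Ambient ι} {g g' : ι → ℤ} (h : HasDegree B f g)
    (h' : HasDegree B f g') : g = g' := by
  obtain ⟨p, q, a, b, hp, hq, hpa, hqb, rfl, rfl⟩ := h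
  obtain ⟨p', q', a', b', hp', hq', hpa', hqb', hf, rfl⟩ := h'
  rw [div_eq_div_iff (algebraMap_ambient_ne_zero hq) (algebraMap_ambient_ne_zero hq'),
    ← map_mul, ← map_mul] at hf
  have hf' : p * q' = p' * q := IsFractionRing.injective _ (Ambient ι) hf
  have h1 := hpa.mul hqb'
  rw [hf'] at h1
  have h2 := h1.inj_right (mul_ne_zero hp' hq) (hpa'.mul hqb)
  rw [sub_eq_sub_iff_add_eq_add]
  exact h2

theorem hasPositiveDegree_var (i : ι ⊕ ι) : HasPositiveDegree B (var i) (weight B i) :=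
  ⟨MvPolynomial.X i, 1, weight B i, 0, by simp, by simp,
    MvPolynomial.isWeightedHomogeneous_X _ _ _, MvPolynomial.isWeightedHomogeneous_one _ _,
    by simp [var], by simp⟩

theorem hasPositiveDegree_one : HasPositiveDegree B 1 0 :=
  ⟨1, 1, 0, 0, by simp, by simp, MvPolynomial.isWeightedHomogeneous_one _ _,
    MvPolynomial.isWeightedHomogeneous_one _ _, by simp, by simp⟩

theorem HasPositiveDegree.mul {f f' : Ambient ι} {g g' : ι → ℤ} (h : HasPositiveDegree B f g)
    (h' : HasPositiveDegree B f' g') : HasPositiveDegree B (f * f') (g + g') := by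
  obtain ⟨p, q, a, b, hp, hq, hpa, hqb, rfl, rfl⟩ := h
  obtain ⟨p', q', a', b', hp', hq', hpa', hqb', rfl, rfl⟩ := h'
  refine ⟨p * p', q * q', a + a', b + b', ?_, ?_, hpa.mul hpa', hqb.mul hqb', ?_, by abel⟩
  · rw [map_mul]; positivity
  · rw [map_mul]; positivity
  · rw [map_mul, map_mul, div_mul_div_comm]

theorem HasPositiveDegree.inv {f : Ambient ι} {g : ι → ℤ} (h : HasPositiveDegree B f g) :
    HasPositiveDegree B f⁻¹ (-g) := by
  obtain ⟨p, q, a, b, hp, hq, hpa, hqb, rfl, rfl⟩ := h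
  exact ⟨q, p, b, a, hq, hp, hqb, hpa, by rw [inv_div], by abel⟩

theorem HasPositiveDegree.add {f f' : Ambient ι} {g : ι → ℤ} (h : HasPositiveDegree B f g)
    (h' : HasPositiveDegree B f' g) : HasPositiveDegree B (f + f') g := by
  obtain ⟨p, q, a, b, hp, hq, hpa, hqb, rfl, rfl⟩ := h
  obtain ⟨p', q', a', b', hp', hq', hpa', hqb', rfl, hg⟩ := h'
  have hab : b + a' = a + b' := by
    rw [sub_eq_sub_iff_add_eq_add] at hg
    rw [hg, add_comm]
  refine ⟨p * q' + q * p', q * q', a + b', b + b', ?_, ?_,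
    (hpa.mul hqb').add (hab ▸ hqb.mul hpa'), hqb.mul hqb', ?_, by abel⟩
  · rw [map_add, map_mul, map_mul]; positivity
  · rw [map_mul]; positivity
  · rw [map_add, map_mul, map_mul, map_mul,
      div_add_div _ _ (algebraMap_ambient_ne_zero (ne_zero_of_eval_pos hq))
        (algebraMap_ambient_ne_zero (ne_zero_of_eval_pos hq'))]

theorem HasPositiveDegree.pow {f : Ambient ι} {g : ι → ℤ} (h : HasPositiveDegree B f g) (n : ℕ) :
    HasPositiveDegree B (f ^ n) (n • g) := by
  induction n with
  | zero => simpa using hasPositiveDegree_one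
  | succ n ih => rw [pow_succ, succ_nsmul]; exact ih.mul h

theorem HasPositiveDegree.prod {κ : Type*} (s : Finset κ) {f : κ → Ambient ι} {g : κ → ι → ℤ}
    (h : ∀ i, HasPositiveDegree B (f i) (g i)) :
    HasPositiveDegree B (∏ i ∈ s, f i) (∑ i ∈ s, g i) := by
  classical
  induction s using Finset.induction_on with
  | empty => simpa using hasPositiveDegree_one
  | insert i s hi ih => rw [Finset.prod_insert hi, Finset.sum_insert hi]; exact (h i).mul ih

theorem weight_apply_perm {σ : Equiv.Perm ι} (hσ : ∀ i j, B (σ i) (σ j) = B i j) (i : ι ⊕ ι)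
    (c : ι) : weight B (Sum.map σ σ i) (σ c) = weight B i c := by
  rcases i with i | i
  · simp [weight, Pi.single_apply]
  · simp [weight, hσ]

/-! ### Combinatorial mutation of degrees -/

/-- An extended exchange matrix together with the degrees of the cluster variables. -/
@[ext]
structure GData (ι : Type) where
  mat : Matrix (ι ⊕ ι) ι ℤ
  deg : ι → ι → ℤ

/-- The exchange matrix and the degrees of the initial seed. -/
def initialGData (B : Matrix ι ι ℤ) : GData ι where
  mat := Matrix.fromRows B 1
  deg := fun j => weight B (Sum.inl j)

/-- `t` records the exchange matrix and the degrees of the cluster variables of `s`. -/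
structure Seed.HasGData (B : Matrix ι ι ℤ) (s : Seed ι) (t : GData ι) : Prop where
  mat_eq : s.mat = t.mat
  hasDegree : ∀ j, HasPositiveDegree B (s.cluster j) (t.deg j)

theorem hasGData_initialSeed : (initialSeed B).HasGData B (initialGData B) where
  mat_eq := rfl
  hasDegree j := hasPositiveDegree_var (Sum.inl j)

variable [Fintype ι]

/-- The degrees of the cluster variables and of the frozen variables. -/
def GData.extended (B : Matrix ι ι ℤ) (s : GData ι) : ι ⊕ ι → ι → ℤ :=
  Sum.elim s.deg fun j => weight B (Sum.inr j)

/-- The effect of a seed mutation on the degrees. -/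
def GData.mutate (B : Matrix ι ι ℤ) (k : ι) (s : GData ι) : GData ι where
  mat := mutateMatrix k s.mat
  deg := Function.update s.deg k (∑ i, (s.mat i k).toNat • s.extended B i - s.deg k)

theorem GData.deg_mutate_self (k : ι) (s : GData ι) :
    (s.mutate B k).deg k = ∑ i, (s.mat i k).toNat • s.extended B i - s.deg k := by
  simp [GData.mutate]

/-- The principal part is skew-symmetric, and both monomials in each exchange relation have the
same degree. -/
structure GData.Balanced (B : Matrix ι ι ℤ) (s : GData ι) : Prop where
  skew : ∀ i j, s.mat (Sum.inl i) j = -s.mat (Sum.inl j) i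
  homogeneous : ∀ j, ∑ i, s.mat i j • s.extended B i = 0

theorem GData.Balanced.diag {s : GData ι} (h : s.Balanced B) (k : ι) :
    s.mat (Sum.inl k) k = 0 := by
  have := h.skew k k
  omega

/-- Since $[b]_+-[-b]_+=b$, the two sides differ by the vanishing sum in `homogeneous`. -/
theorem GData.Balanced.sum_toNat_neg {s : GData ι} (h : s.Balanced B) (k : ι) :
    ∑ i, (-s.mat i k).toNat • s.extended B i = ∑ i, (s.mat i k).toNat • s.extended B i := by
  rw [← sub_eq_zero, ← Finset.sum_sub_distrib, ← neg_eq_zero, ← Finset.sum_neg_distrib,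
    ← h.homogeneous k]
  refine Finset.sum_congr rfl fun i _ => ?_
  rw [neg_sub, ← natCast_zsmul, ← natCast_zsmul, ← sub_smul]
  congr 1
  omega

theorem balanced_initialGData (hB : ∀ i j, B i j = -B j i) : (initialGData B).Balanced B where
  skew i j := by simpa [initialGData] using hB i j
  homogeneous j := by
    ext c
    simp [initialGData, GData.extended, weight, Matrix.one_apply, Pi.single_apply,
      Finset.sum_apply]

theorem GData.extended_mutate (k : ι) (s : GData ι) (i : ι ⊕ ι) :
    (s.mutate B k).extended B i = if i = Sum.inl k then
      ∑ i, (s.mat i k).toNat • s.extended B i - s.deg k else s.extended B i := by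
  rcases i with i | i
  · simp [GData.extended, GData.mutate, Function.update_apply]
  · simp [GData.extended]

/-- With $a=b_{ik}$ and $b=b_{kj}$, the correction in matrix mutation is $b$ times an exponent of
one of the two exchange monomials. The monomial depends only on the sign of $b$, not on the row, so
the corrections can be summed over all rows. -/
theorem sign_mul_max (a b : ℤ) :
    a.sign * max (a * b) 0 = b * ((if 0 ≤ b then a.toNat else (-a).toNat : ℕ) : ℤ) := by
  rcases lt_trichotomy a 0 with ha | rfl | ha
  · rw [Int.sign_eq_neg_one_of_neg ha]
    split_ifs with hb
    · rw [max_eq_right (mul_nonpos_of_nonpos_of_nonneg ha.le hb), Int.toNat_of_nonpos ha.le]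
      simp
    · rw [max_eq_left (mul_nonneg_of_nonpos_of_nonpos ha.le (not_le.1 hb).le),
        Int.toNat_of_nonneg (by omega)]
      ring
  · simp
  · rw [Int.sign_eq_one_of_pos ha]
    split_ifs with hb
    · rw [max_eq_left (mul_nonneg ha.le hb), Int.toNat_of_nonneg ha.le]
      ring
    · rw [max_eq_right (mul_nonpos_of_nonneg_of_nonpos ha.le (not_le.1 hb).le),
        Int.toNat_of_nonpos (by omega)]
      simp

theorem GData.Balanced.mutate {s : GData ι} (h : s.Balanced B) (k : ι) :
    (s.mutate B k).Balanced B where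
  skew i j := by
    have h1 := h.skew i j
    have h2 := h.skew i k
    have h3 := h.skew k j
    simp only [GData.mutate, mutateMatrix, Matrix.of_apply, Sum.inl.injEq]
    by_cases hi : i = k
    · simp [hi, h3]
    by_cases hj : j = k
    · simp [hj, h2]
    rw [if_neg (by tauto), if_neg (by tauto), h1, h2, h3, neg_mul_neg,
      mul_comm (s.mat (Sum.inl j) k)]
    rcases lt_trichotomy (s.mat (Sum.inl k) i) 0 with ha | ha | ha <;>
    rcases lt_trichotomy (s.mat (Sum.inl j) k) 0 with hb | hb | hb <;>
    simp [ha, hb, Int.sign_eq_neg_one_of_neg, Int.sign_eq_one_of_pos,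
      mul_nonpos_of_nonneg_of_nonpos, mul_nonpos_of_nonpos_of_nonneg, ha.le, hb.le] <;> ring
  homogeneous j := by
    by_cases hj : j = k
    · subst hj
      rw [← neg_eq_zero, ← Finset.sum_neg_distrib, ← h.homogeneous j]
      refine Finset.sum_congr rfl fun i _ => ?_
      rw [s.extended_mutate]
      split_ifs with hi
      · simp [GData.mutate, mutateMatrix, hi, h.diag]
      · simp [GData.mutate, mutateMatrix]
    -- Row $k$ receives no correction, as $b_{kk}=0$. There $-b_{kj}(S-\deg x_k)$, with $S$ the
    -- degree of an exchange monomial, exceeds the old term by $-b_{kj}S$. The corrections of all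
    -- rows add up to $b_{kj}S$ and cancel this.
    · have key : ∀ i, (s.mutate B k).mat i j • (s.mutate B k).extended B i =
          s.mat i j • s.extended B i + (s.mat (Sum.inl k) j •
            ((if 0 ≤ s.mat (Sum.inl k) j then (s.mat i k).toNat else (-s.mat i k).toNat) •
              s.extended B i) - if i = Sum.inl k then s.mat (Sum.inl k) j •
                ∑ i, (s.mat i k).toNat • s.extended B i else 0) := by
        intro i
        rw [s.extended_mutate]
        by_cases hi : i = Sum.inl k
        · subst hi
          simp [GData.mutate, mutateMatrix, h.diag, GData.extended, smul_sub]
          abel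
        · rw [if_neg hi, if_neg hi]
          simp only [GData.mutate, mutateMatrix, Matrix.of_apply, hi, hj, or_self, if_false,
            sub_zero]
          rw [sign_mul_max, add_smul, mul_smul, natCast_zsmul]
      rw [Finset.sum_congr rfl fun i _ => key i, Finset.sum_add_distrib, h.homogeneous,
        Finset.sum_sub_distrib, ← Finset.smul_sum]
      have hs : ∑ i, (if 0 ≤ s.mat (Sum.inl k) j then (s.mat i k).toNat else
          (-s.mat i k).toNat) • s.extended B i = ∑ i, (s.mat i k).toNat • s.extended B i := by
        split_ifs
        · rfl
        · exact h.sum_toNat_neg k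
      rw [hs, Finset.sum_ite_eq', if_pos (Finset.mem_univ _), sub_self, add_zero]

/-- The second mutation sees the negated column, hence the other exchange monomial; its degree $S$
is the same, and $S-(S-g)=g$. -/
theorem GData.Balanced.mutate_mutate {s : GData ι} (h : s.Balanced B) (k : ι) :
    (s.mutate B k).mutate B k = s := by
  refine GData.ext mutateMatrix_mutateMatrix ?_
  funext j
  by_cases hj : j = k
  · subst hj
    have : ∑ i, ((s.mutate B j).mat i j).toNat • (s.mutate B j).extended B i =
        ∑ i, (-s.mat i j).toNat • s.extended B i := by
      refine Finset.sum_congr rfl fun i _ => ?_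
      rw [s.extended_mutate]
      split_ifs with hi
      · simp [GData.mutate, mutateMatrix, hi, h.diag]
      · simp [GData.mutate, mutateMatrix]
    rw [GData.deg_mutate_self, this, h.sum_toNat_neg, GData.deg_mutate_self, sub_sub_cancel]
  · simp [GData.mutate, hj]

/-! ### Degrees of the cluster variables -/

theorem Seed.HasGData.mutate {s : Seed ι} {t : GData ι} (h : s.HasGData B t)
    (ht : t.Balanced B) (k : ι) : (s.mutate k).HasGData B (t.mutate B k) where
  mat_eq := by simp [Seed.mutate, GData.mutate, h.mat_eq]
  hasDegree j := by
    have hext : ∀ i, HasPositiveDegree B (s.extended i) (t.extended B i) := by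
      rintro (i | i)
      · exact h.hasDegree i
      · exact hasPositiveDegree_var (Sum.inr i)
    by_cases hj : j = k
    · subst hj
      simp only [Seed.mutate, GData.mutate, Function.update_self, h.mat_eq]
      rw [div_eq_mul_inv, sub_eq_add_neg]
      refine HasPositiveDegree.mul (HasPositiveDegree.add ?_ ?_) (h.hasDegree j).inv
      · exact HasPositiveDegree.prod _ fun i => (hext i).pow _
      · rw [← ht.sum_toNat_neg]
        exact HasPositiveDegree.prod _ fun i => (hext i).pow _
    · simpa [Seed.mutate, GData.mutate, hj] using h.hasDegree j

/-- The exchange matrix and the degrees of the seed at the end of a word, read from right to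
left. -/
def gData (B : Matrix ι ι ℤ) (w : List ι) : GData ι :=
  w.foldr (GData.mutate B) (initialGData B)

theorem balanced_gData (hB : ∀ i j, B i j = -B j i) (w : List ι) : (gData B w).Balanced B := by
  induction w with
  | nil => exact balanced_initialGData hB
  | cons k w ih => exact ih.mutate k

theorem hasGData_seedAt (hB : ∀ i j, B i j = -B j i) (l : List ι) :
    (seedAt B l).HasGData B (gData B l.reverse) := by
  induction l using List.reverseRecOn with
  | nil => exact hasGData_initialSeed
  | append_singleton l k ih =>
    rw [seedAt, List.foldl_append, List.reverse_append]
    exact ih.mutate (balanced_gData hB _) k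

theorem hasDegree_seedAt_iff (hB : ∀ i j, B i j = -B j i) (l : List ι) (j : ι) (g : ι → ℤ) :
    HasDegree B ((seedAt B l).cluster j) g ↔ g = (gData B l.reverse).deg j := by
  have h := ((hasGData_seedAt hB l).hasDegree j).hasDegree
  exact ⟨fun hg => hg.unique h, fun hg => hg ▸ h⟩

theorem isGMatrixAt_iff (hB : ∀ i j, B i j = -B j i) (l : List ι) (M : Matrix ι ι ℤ) :
    IsGMatrixAt B l M ↔ M = Matrix.of fun i j => (gData B l.reverse).deg j i := by
  simp only [IsGMatrixAt, hasDegree_seedAt_iff hB, funext_iff, ← Matrix.ext_iff, Matrix.of_apply]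
  exact forall_comm

/-- Symmetries of the initial exchange matrix act on the degrees. -/
theorem gData_map {σ : Equiv.Perm ι} (hσ : ∀ i j, B (σ i) (σ j) = B i j) (w : List ι) :
    (∀ i j, (gData B (w.map σ)).mat (Sum.map σ σ i) (σ j) = (gData B w).mat i j) ∧
    ∀ i j, (gData B (w.map σ)).deg (σ j) (σ i) = (gData B w).deg j i := by
  induction w with
  | nil =>
    constructor
    · rintro (i | i) j
      · simp [gData, initialGData, hσ]
      · simp [gData, initialGData, Matrix.one_apply]
    · intro i j
      exact weight_apply_perm hσ (Sum.inl j) i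
  | cons k w ih =>
    obtain ⟨h1, h2⟩ := ih
    have hk : ∀ i : ι ⊕ ι, Sum.map σ σ i = Sum.inl (σ k) ↔ i = Sum.inl k := by
      rintro (i | i) <;> simp
    have hl : Sum.inl (σ k) = Sum.map σ σ (Sum.inl k : ι ⊕ ι) := rfl
    constructor
    · intro i j
      change mutateMatrix (σ k) (gData B (w.map σ)).mat _ _ = mutateMatrix k (gData B w).mat _ _
      simp only [mutateMatrix, Matrix.of_apply, hk, σ.injective.eq_iff, h1]
      rw [hl, h1]
    · intro i j
      change (GData.mutate B (σ k) (gData B (w.map σ))).deg _ _ =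
        (GData.mutate B k (gData B w)).deg _ _
      by_cases hj : j = k
      · subst hj
        simp only [GData.mutate, Function.update_self, Pi.sub_apply, h2, Finset.sum_apply]
        congr 1
        refine (Fintype.sum_equiv (Equiv.sumCongr σ σ) _ _ fun c => ?_).symm
        have hc : Equiv.sumCongr σ σ c = Sum.map σ σ c := rfl
        rw [hc, h1, Pi.smul_apply, Pi.smul_apply]
        congr 1
        rcases c with c | c
        · exact (h2 i c).symm
        · exact (weight_apply_perm hσ (Sum.inr c) i).symm
      · have hj' : σ j ≠ σ k := σ.injective.ne hj
        simp [GData.mutate, hj, hj', h2]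

end ClusterPattern

/-! ### Symmetry and coordinate sums for the Markov matrix -/

namespace Markov

open ClusterPattern

theorem markovMatrix_skew (i j : Fin 3) : markovMatrix i j = -markovMatrix j i := by
  fin_cases i <;> fin_cases j <;> rfl

theorem markovMatrix_cyc123 (i j : Fin 3) :
    markovMatrix (cyc123 i) (cyc123 j) = markovMatrix i j := by
  fin_cases i <;> fin_cases j <;> rfl

theorem markovMatrix_cyc132 (i j : Fin 3) :
    markovMatrix (cyc132 i) (cyc132 j) = markovMatrix i j := by
  fin_cases i <;> fin_cases j <;> rfl

/-- Mutations change the principal part of the Markov exchange matrix by a sign. -/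
theorem principalPart_mutateMatrix {b : Matrix (Fin 3 ⊕ Fin 3) (Fin 3) ℤ} {e : ℤ}
    (he : e = 1 ∨ e = -1) (hb : ∀ i j, b (Sum.inl i) j = e * markovMatrix i j) (k i j : Fin 3) :
    mutateMatrix k b (Sum.inl i) j = -e * markovMatrix i j := by
  simp only [mutateMatrix, Matrix.of_apply, Sum.inl.injEq, hb]
  -- For distinct $i,j,k$ the entries $b_{ik}=b_{kj}$ are opposite to $b_{ij}=\pm2$, so the
  -- correction $\mp4$ flips the sign of $b_{ij}$. All cases are checked by evaluation.
  rcases he with rfl | rfl <;> revert i j k <;> clear hb <;> decide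

theorem principalPart_gData (w : List (Fin 3)) : ∃ e : ℤ, (e = 1 ∨ e = -1) ∧
    ∀ i j, (gData markovMatrix w).mat (Sum.inl i) j = e * markovMatrix i j := by
  induction w with
  | nil => exact ⟨1, Or.inl rfl, by simp [gData, initialGData]⟩
  | cons k w ih =>
    obtain ⟨e, he, h⟩ := ih
    exact ⟨-e, by omega, fun i j => principalPart_mutateMatrix he h k i j⟩

theorem sum_weight_frozen (j : Fin 3) : ∑ c, weight markovMatrix (Sum.inr j) c = 0 := by
  revert j; decide

theorem sum_toNat_principalPart {e : ℤ} (he : e = 1 ∨ e = -1) (k : Fin 3) :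
    ∑ i, ((e * markovMatrix i k).toNat : ℤ) = 2 := by
  rcases he with rfl | rfl <;> revert k <;> decide

/-- Frozen variables have coordinate sum $0$, and each column of $\pm B$ has positive part of total
$2$. -/
theorem sum_deg_gData (w : List (Fin 3)) (j : Fin 3) :
    ∑ c, (gData markovMatrix w).deg j c = 1 := by
  induction w generalizing j with
  | nil => revert j; decide
  | cons k w ih =>
    change ∑ c, (GData.mutate markovMatrix k (gData markovMatrix w)).deg j c = 1
    by_cases hj : j = k
    · subst hj
      obtain ⟨e, he, h⟩ := principalPart_gData w
      simp only [GData.mutate, Function.update_self, Pi.sub_apply, Finset.sum_sub_distrib, ih,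
        Finset.sum_apply, Pi.smul_apply]
      rw [Finset.sum_comm]
      simp_rw [← Finset.smul_sum]
      simp only [Fintype.sum_sum_type, GData.extended, Sum.elim_inl,
        Sum.elim_inr, ih, sum_weight_frozen, h,
        nsmul_eq_mul, mul_one, sum_toNat_principalPart he]
      norm_num
    · simpa [GData.mutate, hj] using ih j

end Markov

namespace Farey

/-! ### Order and determinants -/

theorem r_nonneg (p : WithTop ℚ) : 0 ≤ r p := by
  induction p using WithTop.recTopCoe with
  | top => exact le_refl 0
  | coe q => exact Int.natCast_nonneg _

theorem d_eq_one_of_r_eq_zero {p : WithTop ℚ} (h : r p = 0) : d p = 1 := by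
  induction p using WithTop.recTopCoe with
  | top => rfl
  | coe q => exact absurd h (Int.natCast_ne_zero.2 q.den_nz)

theorem lt_iff_mul_lt_mul (p q : WithTop ℚ) : p < q ↔ d p * r q < d q * r p := by
  induction p using WithTop.recTopCoe with
  | top =>
    have := r_nonneg q
    simp only [not_top_lt, d, r, mul_zero, one_mul, false_iff, not_lt]
    exact this
  | coe p =>
    induction q using WithTop.recTopCoe with
    | top => simp [d, r, p.den_pos]
    | coe q => exact WithTop.coe_lt_coe.trans (Rat.lt_iff p q)

theorem eq_of_mul_eq_mul {p q : WithTop ℚ} (h : d p * r q = d q * r p) : p = q := by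
  rcases lt_trichotomy p q with h' | h' | h'
  · rw [lt_iff_mul_lt_mul] at h'; omega
  · exact h'
  · rw [lt_iff_mul_lt_mul] at h'; omega

/-- A common neighbour of two neighbours is their sum or their difference, up to sign. -/
theorem exists_sign_of_Delta {a b c : WithTop ℚ} (hab : Delta a b = 1) (hca : Delta c a = 1)
    (hcb : Delta c b = 1) : ∃ e e' : ℤ, (e = 1 ∨ e = -1) ∧ (e' = 1 ∨ e' = -1) ∧
      d c = e * (d a + e' * d b) ∧ r c = e * (r a + e' * r b) ∧
      ((a < c ∧ c < b ∨ b < c ∧ c < a) ↔ e' = 1) := by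
  simp only [Delta, abs_eq (zero_le_one : (0 : ℤ) ≤ 1)] at hab hca hcb
  simp only [lt_iff_mul_lt_mul]
  generalize hx : d a * r b - d b * r a = x at hab
  generalize hy : d c * r a - d a * r c = y at hca
  generalize hz : d c * r b - d b * r c = z at hcb
  -- Cramer's rule expands $c$ in the basis $a,b$. As $x,y,z=\pm1$, this reads $c=xz\,(a-yz\,b)$.
  -- Moreover $y>0$ means $a<c$ and $z<0$ means $c<b$, so betweenness is $yz=-1$.
  have h1 : x * d c = z * d a - y * d b := by
    rw [← hx, ← hy, ← hz]; ring
  have h2 : x * r c = z * r a - y * r b := by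
    rw [← hx, ← hy, ← hz]; ring
  refine ⟨x * z, -(y * z), ?_, ?_, ?_, ?_, ?_⟩
  · rcases hab with rfl | rfl <;> rcases hcb with rfl | rfl <;> simp
  · rcases hca with rfl | rfl <;> rcases hcb with rfl | rfl <;> simp
  · clear hx hy hz
    rcases hab with rfl | rfl <;> rcases hca with rfl | rfl <;> rcases hcb with rfl | rfl <;>
      linarith
  · clear hx hy hz
    rcases hab with rfl | rfl <;> rcases hca with rfl | rfl <;> rcases hcb with rfl | rfl <;>
      linarith
  · clear h1 h2 hx
    generalize d c * r a = u at *
    generalize d a * r c = u' at *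
    generalize d c * r b = v at *
    generalize d b * r c = v' at *
    rcases hca with rfl | rfl <;> rcases hcb with rfl | rfl <;> norm_num <;> omega

theorem isCoprime_of_Delta {a b : WithTop ℚ} (hab : Delta a b = 1) (e : ℤ) :
    IsCoprime (d a + e * d b) (r a + e * r b) := by
  rcases (abs_eq zero_le_one).1 hab with h | h
  · exact ⟨r b, -d b, by linear_combination h⟩
  · exact ⟨-r b, d b, by linear_combination -h⟩

/-- Mutation exchanges the sum and the difference of the two other components. -/
theorem FareyTriple.exists_exchange (T : FareyTriple) (k : Fin 3) :
    ∃ e e' f : ℤ, (e = 1 ∨ e = -1) ∧ (e' = 1 ∨ e' = -1) ∧ (f = 1 ∨ f = -1) ∧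
      d (T.q k) = e * (d (T.q (k + 1)) + e' * d (T.q (k + 2))) ∧
      r (T.q k) = e * (r (T.q (k + 1)) + e' * r (T.q (k + 2))) ∧
      d (T.newEntry k) = f * (d (T.q (k + 1)) - e' * d (T.q (k + 2))) ∧
      r (T.newEntry k) = f * (r (T.q (k + 1)) - e' * r (T.q (k + 2))) := by
  have hab : Delta (T.q (k + 1)) (T.q (k + 2)) = 1 := T.neighbors _ _ (by revert k; decide)
  obtain ⟨e, e', he, he', h1, h2, h3⟩ := exists_sign_of_Delta hab
    (T.neighbors k (k + 1) (by clear hab; revert k; decide))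
    (T.neighbors k (k + 2) (by clear hab; revert k; decide))
  unfold FareyTriple.newEntry
  split_ifs with hk
  · obtain rfl := h3.1 hk
    obtain ⟨f, hf, h4, h5⟩ := exists_sign_frac (isCoprime_of_Delta hab (-1))
    refine ⟨e, 1, f, he, he', hf, h1, h2, ?_, ?_⟩
    · simpa [diff, ← sub_eq_add_neg] using h4
    · simpa [diff, ← sub_eq_add_neg] using h5
  · obtain rfl : e' = -1 := by tauto
    obtain ⟨f, hf, h4, h5⟩ := exists_sign_frac (isCoprime_of_Delta hab 1)
    refine ⟨e, -1, f, he, he', hf, h1, h2, ?_, ?_⟩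
    · simpa [add] using h4
    · simpa [add] using h5

theorem FareyTriple.mutate_q_self (T : FareyTriple) (k : Fin 3) :
    (T.mutate k).q k = T.newEntry k :=
  Function.update_self ..

theorem FareyTriple.mutate_q_of_ne (T : FareyTriple) {k j : Fin 3} (h : j ≠ k) :
    (T.mutate k).q j = T.q j :=
  Function.update_of_ne h ..

theorem add_one_ne_self (k : Fin 3) : k + 1 ≠ k := by revert k; decide

theorem add_two_ne_self (k : Fin 3) : k + 2 ≠ k := by revert k; decide

theorem eq_or_eq_add_one_or_eq_add_two (j k : Fin 3) : j = k ∨ j = k + 1 ∨ j = k + 2 := by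
  revert j k; decide

theorem FareyTriple.Delta_add_one_add_two (T : FareyTriple) (k : Fin 3) :
    Delta (T.q (k + 1)) (T.q (k + 2)) = 1 :=
  T.neighbors _ _ (by revert k; decide)

theorem FareyTriple.newEntry_mutate (T : FareyTriple) (k : Fin 3) :
    (T.mutate k).newEntry k = T.q k := by
  obtain ⟨e, e', f, he, he', hf, h1, h2, h3, h4⟩ := T.exists_exchange k
  obtain ⟨u, u', v, hu, hu', hv, h5, h6, h7, h8⟩ := (T.mutate k).exists_exchange k
  rw [T.mutate_q_self, T.mutate_q_of_ne (add_one_ne_self k),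
    T.mutate_q_of_ne (add_two_ne_self k)] at h5 h6
  rw [T.mutate_q_of_ne (add_one_ne_self k), T.mutate_q_of_ne (add_two_ne_self k)] at h7 h8
  have hab := T.Delta_add_one_add_two k
  rw [Delta] at hab
  rw [h3] at h5
  rw [h4] at h6
  -- If $u'=e'$, the vectors $a-e'b$ and $a+e'b$ would agree up to sign, so $a$ or $b$ would vanish,
  -- against determinant $\pm1$.
  have hu'' : u' = -e' := by
    by_contra hne
    have hue : u' = e' := by omega
    subst hue
    generalize d (T.q (k + 1)) = da at *
    generalize d (T.q (k + 2)) = db at *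
    generalize r (T.q (k + 1)) = ra at *
    generalize r (T.q (k + 2)) = rb at *
    have hor : (da = 0 ∧ ra = 0) ∨ (db = 0 ∧ rb = 0) := by
      clear h1 h2 h7 h8 hab
      rcases hu with rfl | rfl <;> rcases hu' with rfl | rfl <;> rcases hf with rfl | rfl <;> omega
    rcases hor with ⟨rfl, rfl⟩ | ⟨rfl, rfl⟩ <;> simp at hab
  apply eq_of_mul_eq_mul
  rw [h1, h2, h7, h8, hu'']
  ring

theorem FareyTriple.mutate_mutate (T : FareyTriple) (k : Fin 3) :
    (T.mutate k).mutate k = T := by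
  ext1
  funext j
  by_cases hj : j = k
  · subst hj
    rw [FareyTriple.mutate_q_self, T.newEntry_mutate]
  · rw [FareyTriple.mutate_q_of_ne _ hj, FareyTriple.mutate_q_of_ne _ hj]

/-! ### Descent along the quadratic form `d² + dr + r²` -/

/-- The value of the quadratic form `d² + dr + r²` at a fraction. -/
def form (p : WithTop ℚ) : ℤ := d p ^ 2 + d p * r p + r p ^ 2

theorem form_pos (p : WithTop ℚ) : 0 < form p := by
  unfold form
  rcases (r_nonneg p).eq_or_lt with h | h
  · rw [← h, d_eq_one_of_r_eq_zero h.symm]; norm_num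
  · nlinarith [sq_nonneg (2 * d p + r p), pow_pos h 2]

/-- With $r\ge0$, the form takes its minimum $1$ only at $1/0$, $0/1$ and $-1/1$, the entries of the
initial triple, which lie in different parity classes. -/
theorem eq_of_form_eq_one {p q : WithTop ℚ} {i : Fin 3} (hp : form p = 1) (hq : form q = 1)
    (hpi : HasClass p i) (hqi : HasClass q i) : p = q := by
  have key : ∀ p : WithTop ℚ, form p = 1 →
      (d p = 1 ∧ r p = 0) ∨ (d p = 0 ∧ r p = 1) ∨ (d p = -1 ∧ r p = 1) := by
    intro p hp
    rcases (r_nonneg p).eq_or_lt with h | h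
    · exact Or.inl ⟨d_eq_one_of_r_eq_zero h.symm, h.symm⟩
    · right
      unfold form at hp
      have h1 : r p = 1 := by nlinarith [sq_nonneg (2 * d p + r p)]
      rw [h1] at hp
      have h2 : d p * (d p + 1) = 0 := by linarith
      rcases mul_eq_zero.1 h2 with h2 | h2
      · exact Or.inl ⟨h2, h1⟩
      · exact Or.inr ⟨by omega, h1⟩
  apply eq_of_mul_eq_mul
  have hi : i = 0 ∨ i = 1 ∨ i = 2 := by clear hpi hqi; revert i; decide
  rcases hi with rfl | rfl | rfl <;>
    simp only [HasClass, Int.even_iff, Int.odd_iff] at hpi hqi <;>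
    rcases key p hp with ⟨h1, h2⟩ | ⟨h1, h2⟩ | ⟨h1, h2⟩ <;>
    rcases key q hq with ⟨h3, h4⟩ | ⟨h3, h4⟩ | ⟨h3, h4⟩ <;>
    rw [h1, h2] at hpi <;> rw [h3, h4] at hqi <;> rw [h1, h2, h3, h4] <;> simp at hpi hqi

theorem form_initialTriple (i : Fin 3) : form (initialTriple.q i) = 1 := by
  fin_cases i <;> rfl

/-- The parallelogram law: the old and new components are, up to sign, the sum and the difference of
the other two. -/
theorem FareyTriple.form_newEntry (T : FareyTriple) (k : Fin 3) :
    form (T.newEntry k) = 2 * form (T.q (k + 1)) + 2 * form (T.q (k + 2)) - form (T.q k) := by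
  obtain ⟨e, e', f, he, he', hf, h1, h2, h3, h4⟩ := T.exists_exchange k
  unfold form
  rw [h1, h2, h3, h4]
  rcases he with rfl | rfl <;> rcases he' with rfl | rfl <;> rcases hf with rfl | rfl <;> ring

/-- Equality would make the other two components orthogonal for the polar form. That pairing is
congruent mod $2$ to their determinant $\pm1$, hence odd. -/
theorem FareyTriple.form_ne (T : FareyTriple) (k : Fin 3) :
    form (T.q k) ≠ form (T.q (k + 1)) + form (T.q (k + 2)) := by
  obtain ⟨e, e', f, he, he', -, h1, h2, -, -⟩ := T.exists_exchange k
  have hab := (abs_eq zero_le_one).1 (T.Delta_add_one_add_two k)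
  unfold form
  rw [h1, h2]
  generalize d (T.q (k + 1)) = da at *
  generalize d (T.q (k + 2)) = db at *
  generalize r (T.q (k + 1)) = ra at *
  generalize r (T.q (k + 2)) = rb at *
  clear h1 h2
  intro h
  have h' : e' * (2 * (da * db) + da * rb + db * ra + 2 * (ra * rb)) = 0 := by
    rcases he with rfl | rfl <;> rcases he' with rfl | rfl <;> linear_combination h
  have h'' := (mul_eq_zero.1 h').resolve_left (by omega)
  generalize da * rb = x at *
  generalize db * ra = y at *
  omega

/-- The Gram determinant of two neighbours: minus the discriminant of the form, $3$, times the
squared determinant $1$. -/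
theorem FareyTriple.form_discriminant (T : FareyTriple) (k : Fin 3) :
    4 * form (T.q (k + 1)) * form (T.q (k + 2)) -
      (form (T.q k) - form (T.q (k + 1)) - form (T.q (k + 2))) ^ 2 = 3 := by
  obtain ⟨e, e', f, he, he', -, h1, h2, -, -⟩ := T.exists_exchange k
  have hab := sq_abs (d (T.q (k + 1)) * r (T.q (k + 2)) - d (T.q (k + 2)) * r (T.q (k + 1)))
  have hD := T.Delta_add_one_add_two k
  rw [Delta] at hD
  rw [hD] at hab
  unfold form
  rw [h1, h2]
  rcases he with rfl | rfl <;> rcases he' with rfl | rfl <;> linear_combination -3 * hab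

/-- The component `T.q k` has a larger value than its replacement. -/
def FareyTriple.Descends (T : FareyTriple) (k : Fin 3) : Prop :=
  form (T.q (k + 1)) + form (T.q (k + 2)) < form (T.q k)

/-- By `form_newEntry`, mutation negates the difference between the value at $k$ and the sum of the
two other values; by `form_ne` it is not zero. -/
theorem FareyTriple.descends_mutate_iff (T : FareyTriple) (k : Fin 3) :
    (T.mutate k).Descends k ↔ ¬T.Descends k := by
  have h := T.form_newEntry k
  have h' := T.form_ne k
  unfold FareyTriple.Descends
  rw [T.mutate_q_self, T.mutate_q_of_ne (add_one_ne_self k), T.mutate_q_of_ne (add_two_ne_self k)]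
  omega

theorem FareyTriple.Descends.unique {T : FareyTriple} {j k : Fin 3} (hj : T.Descends j)
    (hk : T.Descends k) : j = k := by
  have h1 := form_pos (T.q k)
  have h2 := form_pos (T.q (k + 1))
  have h3 := form_pos (T.q (k + 2))
  unfold FareyTriple.Descends at hj hk
  have e1 : k + 1 + 1 = k + 2 := by clear hj hk h1 h2 h3; revert k; decide
  have e2 : k + 1 + 2 = k := by clear hj hk h1 h2 h3 e1; revert k; decide
  have e3 : k + 2 + 1 = k := by clear hj hk h1 h2 h3 e1 e2; revert k; decide
  have e4 : k + 2 + 2 = k + 1 := by clear hj hk h1 h2 h3 e1 e2 e3; revert k; decide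
  rcases eq_or_eq_add_one_or_eq_add_two j k with rfl | rfl | rfl
  · rfl
  · rw [e1, e2] at hj
    omega
  · rw [e3, e4] at hj
    omega

theorem not_descends_initialTriple (k : Fin 3) : ¬initialTriple.Descends k := by
  simp [FareyTriple.Descends, form_initialTriple]

theorem FareyTriple.exists_descends {T : FareyTriple} (hT : T ≠ initialTriple) :
    ∃ k, T.Descends k := by
  by_contra! h
  refine hT (FareyTriple.ext (funext fun i => ?_))
  refine eq_of_form_eq_one ?_ (form_initialTriple i) (T.parity i) (initialTriple.parity i)
  have hd := T.form_discriminant 0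
  have h' : ∀ k, form (T.q k) < form (T.q (k + 1)) + form (T.q (k + 2)) := fun k =>
    lt_of_le_of_ne (not_lt.1 (h k)) (T.form_ne k)
  have h0 : form (T.q 0) < form (T.q 1) + form (T.q 2) := h' 0
  have h1 : form (T.q 1) < form (T.q 2) + form (T.q 0) := h' 1
  have h2 : form (T.q 2) < form (T.q 0) + form (T.q 1) := h' 2
  replace hd : 4 * form (T.q 1) * form (T.q 2) -
      (form (T.q 0) - form (T.q 1) - form (T.q 2)) ^ 2 = 3 := hd
  have h3 : form (T.q 0) = 1 ∧ form (T.q 1) = 1 ∧ form (T.q 2) = 1 := by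
    generalize form (T.q 0) = a at *
    generalize form (T.q 1) = b at *
    generalize form (T.q 2) = c at *
    -- Without a descent the values satisfy strict triangle inequalities; $x,y,z\ge0$ are the
    -- slacks. The discriminant identity becomes a vanishing sum of nonnegative terms, so $x=y=z=0$
    -- and all values are $1$.
    obtain ⟨x, hx⟩ : ∃ x, x = b + c - a - 1 := ⟨_, rfl⟩
    obtain ⟨y, hy⟩ : ∃ y, y = c + a - b - 1 := ⟨_, rfl⟩
    obtain ⟨z, hz⟩ : ∃ z, z = a + b - c - 1 := ⟨_, rfl⟩
    have hx0 : 0 ≤ x := by omega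
    have hy0 : 0 ≤ y := by omega
    have hz0 : 0 ≤ z := by omega
    have hs : x * y + y * z + z * x + 2 * (x + y + z) = 0 := by
      rw [hx, hy, hz]
      linear_combination hd
    have := mul_nonneg hx0 hy0
    have := mul_nonneg hy0 hz0
    have := mul_nonneg hz0 hx0
    omega
  fin_cases i
  · exact h3.1
  · exact h3.2.1
  · exact h3.2.2

/-- A measure of the size of a Farey triple, minimal at the initial triple. -/
def FareyTriple.height (T : FareyTriple) : ℕ := (∑ i, form (T.q i)).toNat

theorem FareyTriple.Descends.height_lt {T : FareyTriple} {k : Fin 3} (h : T.Descends k) :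
    (T.mutate k).height < T.height := by
  have hsum : ∀ S : FareyTriple,
      ∑ i, form (S.q i) = form (S.q k) + form (S.q (k + 1)) + form (S.q (k + 2)) := by
    intro S
    clear h
    rw [Fin.sum_univ_three]
    fin_cases k
    · rfl
    · change _ = form (S.q 1) + form (S.q 2) + form (S.q 0); ring
    · change _ = form (S.q 2) + form (S.q 0) + form (S.q 1); ring
  unfold FareyTriple.height
  have h1 := form_pos (T.q k)
  have h2 := form_pos (T.q (k + 1))
  have h3 := form_pos (T.q (k + 2))
  rw [hsum, hsum, T.mutate_q_self, T.mutate_q_of_ne (add_one_ne_self k),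
    T.mutate_q_of_ne (add_two_ne_self k), T.form_newEntry]
  unfold FareyTriple.Descends at h
  omega

/-! ### Farey triples and words -/

/-- The triple at the end of a word, read from right to left. -/
def tripleAt (w : List (Fin 3)) : FareyTriple :=
  w.foldr FareyTriple.mutate initialTriple

theorem tripleAt_surjective : Function.Surjective tripleAt := by
  intro T
  induction hn : T.height using Nat.strong_induction_on generalizing T with
  | _ n ih =>
    by_cases hT : T = initialTriple
    · exact ⟨[], hT.symm⟩
    · obtain ⟨k, hk⟩ := FareyTriple.exists_descends hT
      obtain ⟨w, hw⟩ := ih _ (hn ▸ hk.height_lt) (T.mutate k) rfl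
      refine ⟨k :: w, ?_⟩
      change (tripleAt w).mutate k = T
      rw [hw, T.mutate_mutate]

/-- The previous triple descends only along its own last mutation, so a different letter ascends and
becomes the descent of the new triple. -/
theorem descends_tripleAt_cons {k : Fin 3} {w : List (Fin 3)}
    (h : (k :: w).IsChain (· ≠ ·)) : (tripleAt (k :: w)).Descends k := by
  induction w generalizing k with
  | nil => exact (FareyTriple.descends_mutate_iff _ _).2 (not_descends_initialTriple k)
  | cons j w ih =>
    rw [List.isChain_cons_cons] at h
    exact (FareyTriple.descends_mutate_iff _ _).2 fun hk => h.1 (hk.unique (ih h.2))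

/-- The head of a reduced word is recovered as the unique descent of its triple, and can then be
stripped off. -/
theorem tripleAt_injOn : Set.InjOn tripleAt {w | w.IsChain (· ≠ ·)} := by
  intro w hw w' hw' h
  induction w generalizing w' with
  | nil =>
    cases w' with
    | nil => rfl
    | cons k w' =>
      have := descends_tripleAt_cons hw'
      rw [← h] at this
      exact absurd this (not_descends_initialTriple k)
  | cons k w ih =>
    cases w' with
    | nil =>
      have := descends_tripleAt_cons hw
      rw [h] at this
      exact absurd this (not_descends_initialTriple k)
    | cons k' w' =>
      have h1 := descends_tripleAt_cons hw
      rw [h] at h1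
      obtain rfl := h1.unique (descends_tripleAt_cons hw')
      have h2 := congrArg (FareyTriple.mutate k) h
      change ((tripleAt w).mutate k).mutate k = ((tripleAt w').mutate k).mutate k at h2
      rw [FareyTriple.mutate_mutate, FareyTriple.mutate_mutate] at h2
      rw [ih hw.of_cons hw'.of_cons h2]

/-- Cancellation of equal adjacent letters. -/
def reduce : List (Fin 3) → List (Fin 3)
  | [] => []
  | k :: w =>
    match reduce w with
    | [] => [k]
    | j :: v => if j = k then v else k :: j :: v

theorem isChain_reduce (w : List (Fin 3)) : (reduce w).IsChain (· ≠ ·) := by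
  induction w with
  | nil => exact List.isChain_nil
  | cons k w ih =>
    rw [reduce]
    cases hw : reduce w with
    | nil => exact List.isChain_singleton k
    | cons j v =>
      rw [hw] at ih
      dsimp only
      split_ifs with hj
      · exact ih.of_cons
      · exact List.isChain_cons_cons.2 ⟨fun h => hj h.symm, ih⟩

/-- Involutivity is required only at states reachable from `x`: mutation of degrees is shown to be
involutive on balanced data only. -/
theorem foldr_reduce {X : Type*} (m : Fin 3 → X → X) (x : X)
    (hm : ∀ w k, m k (m k (List.foldr m x w)) = List.foldr m x w) (w : List (Fin 3)) :
    (reduce w).foldr m x = w.foldr m x := by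
  induction w with
  | nil => rfl
  | cons k w ih =>
    rw [List.foldr_cons, ← ih, reduce]
    cases reduce w with
    | nil => rfl
    | cons j v =>
      dsimp only
      split_ifs with hj
      · rw [hj, List.foldr_cons, hm]
      · rfl

/-- Words with the same Farey triple act in the same way under any involutions. -/
theorem foldr_eq_of_tripleAt_eq {X : Type*} (m : Fin 3 → X → X) (x : X)
    (hm : ∀ w k, m k (m k (List.foldr m x w)) = List.foldr m x w) {w w' : List (Fin 3)}
    (h : tripleAt w = tripleAt w') : w.foldr m x = w'.foldr m x := by
  have hr : ∀ v, tripleAt (reduce v) = tripleAt v :=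
    foldr_reduce FareyTriple.mutate initialTriple fun _ _ => FareyTriple.mutate_mutate _ _
  rw [← hr w, ← hr w'] at h
  rw [← foldr_reduce m x hm w, ← foldr_reduce m x hm w',
    tripleAt_injOn (isChain_reduce w) (isChain_reduce w') h]

end Farey

namespace Farey

/-! ### Relabelling of Farey triples -/

/-- The automorphism of the exchange graph that fixes the initial triple and permutes the edge
labels by `σ`. -/
noncomputable def relabel (σ : Equiv.Perm (Fin 3)) (T : FareyTriple) : FareyTriple :=
  tripleAt ((Function.surjInv tripleAt_surjective T).map σ)

/-- The word chosen in `relabel` is immaterial: the mutations $\mu_{\sigma(k)}$ are involutions as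
well, so words with the same triple act alike. -/
theorem relabel_tripleAt (σ : Equiv.Perm (Fin 3)) (w : List (Fin 3)) :
    relabel σ (tripleAt w) = tripleAt (w.map σ) := by
  have h : ∀ v : List (Fin 3), tripleAt (v.map σ) =
      v.foldr (fun k => FareyTriple.mutate (σ k)) initialTriple := fun _ => List.foldr_map
  rw [relabel, h, h]
  exact foldr_eq_of_tripleAt_eq _ _ (fun _ _ => FareyTriple.mutate_mutate _ _)
    (Function.surjInv_eq tripleAt_surjective _)

theorem relabel_mutate (σ : Equiv.Perm (Fin 3)) (T : FareyTriple) (k : Fin 3) :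
    relabel σ (T.mutate k) = (relabel σ T).mutate (σ k) := by
  obtain ⟨w, rfl⟩ := tripleAt_surjective T
  rw [relabel_tripleAt]
  exact relabel_tripleAt σ (k :: w)

theorem relabel_initialTriple (σ : Equiv.Perm (Fin 3)) :
    relabel σ initialTriple = initialTriple :=
  relabel_tripleAt σ []

theorem relabel_inv_relabel (σ : Equiv.Perm (Fin 3)) (T : FareyTriple) :
    relabel σ⁻¹ (relabel σ T) = T := by
  obtain ⟨w, rfl⟩ := tripleAt_surjective T
  rw [relabel_tripleAt, relabel_tripleAt, List.map_map]
  simp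

theorem relabel_relabel_inv (σ : Equiv.Perm (Fin 3)) (T : FareyTriple) :
    relabel σ (relabel σ⁻¹ T) = T := by
  simpa using relabel_inv_relabel σ⁻¹ T

theorem relabel_injective (σ : Equiv.Perm (Fin 3)) : Function.Injective (relabel σ) :=
  Function.LeftInverse.injective (relabel_inv_relabel σ)

theorem FareyTriple.mutate_ne_self (T : FareyTriple) (k : Fin 3) : T.mutate k ≠ T := by
  intro h
  have := T.descends_mutate_iff k
  rw [h] at this
  tauto

theorem exchangeGraph_adj_iff (S T : FareyTriple) :
    exchangeGraph.Adj S T ↔ ∃ k, T = S.mutate k := by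
  rw [exchangeGraph, SimpleGraph.fromRel_adj]
  constructor
  · rintro ⟨-, ⟨k, h⟩ | ⟨k, h⟩⟩
    · exact ⟨k, h⟩
    · exact ⟨k, by rw [h, T.mutate_mutate]⟩
  · rintro ⟨k, rfl⟩
    exact ⟨(S.mutate_ne_self k).symm, Or.inl ⟨k, rfl⟩⟩

theorem exchangeGraph_adj_relabel_iff (σ : Equiv.Perm (Fin 3)) (S T : FareyTriple) :
    exchangeGraph.Adj (relabel σ S) (relabel σ T) ↔ exchangeGraph.Adj S T := by
  rw [exchangeGraph_adj_iff, exchangeGraph_adj_iff, ← σ.exists_congr_right]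
  simp only [← relabel_mutate, (relabel_injective σ).eq_iff]

theorem mutate_mem_component {i : Fin 3} {S : FareyTriple} (hS : S ∈ component i) {k : Fin 3}
    (hk : S.mutate k ≠ initialTriple) : S.mutate k ∈ component i := by
  obtain ⟨h, hr⟩ := hS
  refine ⟨hk, hr.trans (SimpleGraph.Adj.reachable ?_)⟩
  exact (exchangeGraph_adj_iff _ _).2 ⟨k, rfl⟩

theorem component_induction {i : Fin 3} {P : FareyTriple → Prop} (base : P (initialTriple.mutate i))
    (mutate : ∀ S ∈ component i, P S → ∀ k, S.mutate k ∈ component i → P (S.mutate k))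
    {T : FareyTriple} (hT : T ∈ component i) : P T := by
  obtain ⟨h, hr⟩ := hT
  rw [SimpleGraph.reachable_iff_reflTransGen] at hr
  suffices ∀ x, Relation.ReflTransGen puncturedGraph.Adj
      ⟨initialTriple.mutate i, mutate_initialTriple_ne i⟩ x → P x.1 from this _ hr
  intro x hx
  induction hx with
  | refl => exact base
  | @tail y z hy hyz ih =>
    obtain ⟨k, hk⟩ := (exchangeGraph_adj_iff _ _).1 hyz
    have hy' : y.1 ∈ component i :=
      ⟨y.2, (SimpleGraph.reachable_iff_reflTransGen _ _).2 hy⟩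
    replace hk : z.1 = y.1.mutate k := hk
    rw [hk]
    exact mutate _ hy' ih k (mutate_mem_component hy' (hk ▸ z.2))

/-- Relabelling fixes the initial triple and is injective, so paths avoiding that triple go to paths
avoiding it. -/
theorem relabel_mem_component (σ : Equiv.Perm (Fin 3)) {i : Fin 3} {T : FareyTriple}
    (hT : T ∈ component i) : relabel σ T ∈ component (σ i) := by
  refine component_induction (P := fun T => relabel σ T ∈ component (σ i)) ?_
    (fun S _ ih k hk => ?_) hT
  · rw [relabel_mutate, relabel_initialTriple]
    exact (base (σ i)).2
  · rw [relabel_mutate]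
    refine mutate_mem_component ih fun h => hk.1 (relabel_injective σ ?_)
    rw [relabel_mutate, h, relabel_initialTriple]

theorem exists_mem_component {T : FareyTriple} (hT : T ≠ initialTriple) :
    ∃ i, T ∈ component i := by
  obtain ⟨w, rfl⟩ := tripleAt_surjective T
  induction w with
  | nil => exact absurd rfl hT
  | cons k w ih =>
    by_cases hw : tripleAt w = initialTriple
    · refine ⟨k, ?_⟩
      change (tripleAt w).mutate k ∈ component k
      rw [hw]
      exact (base k).2
    · obtain ⟨i, hi⟩ := ih hw
      exact ⟨i, mutate_mem_component hi hT⟩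

/-- The isomorphism between components of the punctured exchange graph induced by a relabelling. -/
noncomputable def componentIso (σ : Equiv.Perm (Fin 3)) {i j : Fin 3} (h : σ i = j) :
    exchangeGraph.induce (component i) ≃g exchangeGraph.induce (component j) where
  toFun T := ⟨relabel σ T.1, h ▸ relabel_mem_component σ T.2⟩
  invFun T := ⟨relabel σ⁻¹ T.1, by
    simpa [← h] using relabel_mem_component σ⁻¹ T.2⟩
  left_inv T := Subtype.ext (relabel_inv_relabel σ T.1)
  right_inv T := Subtype.ext (relabel_relabel_inv σ T.1)
  map_rel_iff' := exchangeGraph_adj_relabel_iff σ _ _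

theorem isLabelledIso_componentIso (σ : Equiv.Perm (Fin 3)) {i j : Fin 3} (h : σ i = j) :
    IsLabelledIso σ (componentIso σ h) := by
  refine ⟨Subtype.ext ?_, fun S T k hk => ?_⟩
  · change relabel σ (initialTriple.mutate i) = initialTriple.mutate j
    rw [relabel_mutate, relabel_initialTriple, h]
  · change relabel σ T.1 = (relabel σ S.1).mutate (σ k)
    rw [hk, relabel_mutate]

/-- The image of the base vertex and the edge labels determine the map along every path. -/
theorem IsLabelledIso.eq_relabel {σ : Equiv.Perm (Fin 3)} {i j : Fin 3} (h : σ i = j)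
    {f : exchangeGraph.induce (component i) ≃g exchangeGraph.induce (component j)}
    (hf : IsLabelledIso σ f) (T : component i) : (f T).1 = relabel σ T.1 := by
  refine component_induction (P := fun T => ∀ hT : T ∈ component i, (f ⟨T, hT⟩).1 = relabel σ T)
    (fun hT => ?_) (fun S hS ih k hk hk' => ?_) T.2 T.2
  · rw [relabel_mutate, relabel_initialTriple, h]
    exact congrArg Subtype.val hf.1
  · rw [relabel_mutate, ← ih hS]
    exact hf.2 ⟨S, hS⟩ ⟨S.mutate k, hk⟩ k rfl

theorem existsUnique_isLabelledIso (σ : Equiv.Perm (Fin 3)) {i j : Fin 3} (h : σ i = j) :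
    ∃! f : exchangeGraph.induce (component i) ≃g exchangeGraph.induce (component j),
      IsLabelledIso σ f :=
  ⟨componentIso σ h, isLabelledIso_componentIso σ h, fun _ hf =>
    RelIso.ext fun T => Subtype.ext (hf.eq_relabel h T)⟩

end Farey

namespace Markov

open ClusterPattern Farey

/-! ### The g-matrices of Farey triples -/

/-- The g-matrix of the seed at the end of a word, read from right to left. -/
def gMatrix (w : List (Fin 3)) : Matrix (Fin 3) (Fin 3) ℤ :=
  Matrix.of fun i j => (gData markovMatrix w).deg j i

theorem isGMatrixAt_markovMatrix_iff (l : List (Fin 3)) (M : Matrix (Fin 3) (Fin 3) ℤ) :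
    IsGMatrixAt markovMatrix l M ↔ M = gMatrix l.reverse :=
  isGMatrixAt_iff markovMatrix_skew l M

theorem isGMatrixOf_iff_exists (T : FareyTriple) (M : Matrix (Fin 3) (Fin 3) ℤ) :
    IsGMatrixOf T M ↔ ∃ w, tripleAt w = T ∧ M = gMatrix w := by
  simp only [IsGMatrixOf, isGMatrixAt_markovMatrix_iff]
  constructor
  · rintro ⟨l, rfl, h⟩
    exact ⟨l.reverse, List.foldr_reverse, h⟩
  · rintro ⟨w, rfl, h⟩
    exact ⟨w.reverse, List.foldl_reverse.symm, by rwa [List.reverse_reverse]⟩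

/-- This makes the g-matrix a function of the Farey triple: the degree data reached along words are
balanced, so their mutations undo each other. -/
theorem gMatrix_eq_of_tripleAt_eq {w w' : List (Fin 3)} (h : tripleAt w = tripleAt w') :
    gMatrix w = gMatrix w' := by
  have : gData markovMatrix w = gData markovMatrix w' :=
    foldr_eq_of_tripleAt_eq _ _
      (fun v k => (balanced_gData markovMatrix_skew v).mutate_mutate k) h
  rw [gMatrix, gMatrix, this]

theorem isGMatrixOf_tripleAt_iff (w : List (Fin 3)) (M : Matrix (Fin 3) (Fin 3) ℤ) :
    IsGMatrixOf (tripleAt w) M ↔ M = gMatrix w := by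
  rw [isGMatrixOf_iff_exists]
  constructor
  · rintro ⟨v, hv, rfl⟩
    exact gMatrix_eq_of_tripleAt_eq hv
  · exact fun h => ⟨w, rfl, h⟩

theorem gMatrix_map {σ : Equiv.Perm (Fin 3)}
    (hσ : ∀ i j, markovMatrix (σ i) (σ j) = markovMatrix i j) (w : List (Fin 3)) :
    gMatrix (w.map σ) = permAct σ (gMatrix w) := by
  ext i j
  simpa [gMatrix, permAct] using (gData_map hσ w).2 (σ.symm i) (σ.symm j)

theorem isGMatrixOf_relabel_iff {σ : Equiv.Perm (Fin 3)}
    (hσ : ∀ i j, markovMatrix (σ i) (σ j) = markovMatrix i j) (T : FareyTriple)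
    (M : Matrix (Fin 3) (Fin 3) ℤ) :
    IsGMatrixOf (relabel σ T) (permAct σ M) ↔ IsGMatrixOf T M := by
  obtain ⟨w, rfl⟩ := tripleAt_surjective T
  rw [relabel_tripleAt, isGMatrixOf_tripleAt_iff, isGMatrixOf_tripleAt_iff, gMatrix_map hσ]
  exact (Matrix.reindex σ σ).injective.eq_iff

/-! ### The set of g-vectors -/

theorem mem_gVectors_iff (g : Fin 3 → ℤ) :
    g ∈ gVectors markovMatrix ↔ ∃ T M, IsGMatrixOf T M ∧ ∃ j, g = M.col j := by
  simp only [gVectors, Set.mem_ofPred_eq, hasDegree_seedAt_iff markovMatrix_skew]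
  constructor
  · rintro ⟨l, j, h⟩
    exact ⟨tripleAt l.reverse, gMatrix l.reverse, (isGMatrixOf_tripleAt_iff _ _).2 rfl, j, h⟩
  · rintro ⟨T, M, h, j, hj⟩
    obtain ⟨w, -, rfl⟩ := (isGMatrixOf_iff_exists T M).1 h
    exact ⟨w.reverse, j, by rwa [List.reverse_reverse]⟩

theorem permAct_inv_permAct (σ : Equiv.Perm (Fin 3)) (M : Matrix (Fin 3) (Fin 3) ℤ) :
    permAct σ (permAct σ⁻¹ M) = M := by
  ext i j
  simp [permAct, Equiv.Perm.inv_def]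

/-- The g-matrices of the triples in one component are permuted g-matrices of the triples in any
other component. -/
theorem exists_isGMatrixOf_of_mem_component {σ : Equiv.Perm (Fin 3)}
    (hσ : ∀ i j, markovMatrix (σ i) (σ j) = markovMatrix i j) {i : Fin 3} {T : FareyTriple}
    (hT : T ∈ component (σ i)) {M : Matrix (Fin 3) (Fin 3) ℤ} (hM : IsGMatrixOf T M) :
    ∃ (S : component i) (N : Matrix (Fin 3) (Fin 3) ℤ), IsGMatrixOf S.1 N ∧ M = permAct σ N := by
  refine ⟨⟨relabel σ⁻¹ T, by simpa using relabel_mem_component σ⁻¹ hT⟩, permAct σ⁻¹ M, ?_,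
    (permAct_inv_permAct σ M).symm⟩
  rw [← isGMatrixOf_relabel_iff hσ, permAct_inv_permAct, relabel_relabel_inv]
  exact hM

theorem gVectors_markovMatrix :
    gVectors markovMatrix =
      {g | ∃ (T : component 1) (M : Matrix (Fin 3) (Fin 3) ℤ), IsGMatrixOf T.1 M ∧
        ∃ j, g = M.col j ∨ g = (permAct cyc123 M).col j ∨ g = (permAct cyc132 M).col j} := by
  ext g
  rw [mem_gVectors_iff]
  constructor
  · rintro ⟨T, M, hM, j, rfl⟩
    by_cases hT : T = initialTriple
    · subst hT
      obtain rfl := (isGMatrixOf_tripleAt_iff [] M).1 hM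
      -- The initial triple lies in no component, and its g-matrix is the identity. Mutation at $-1$
      -- keeps the first and third columns $\mathbf e_1,\mathbf e_3$; the cycle $(123)$ carries
      -- $\mathbf e_1$ to $\mathbf e_2$.
      refine ⟨base 1, gMatrix [1], (isGMatrixOf_tripleAt_iff [1] _).2 rfl, j, ?_⟩
      fin_cases j
      · left; decide
      · right; left; decide
      · left; decide
    · obtain ⟨i, hi⟩ := exists_mem_component hT
      -- The three components are the images of $\mathbb T_3^{-1}$ under the cyclic group, which
      -- acts transitively on the labels.
      have h3 : i = 1 ∨ i = cyc123 1 ∨ i = cyc132 1 := by clear hi; revert i; decide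
      rcases h3 with rfl | rfl | rfl
      · exact ⟨⟨T, hi⟩, M, hM, j, Or.inl rfl⟩
      · obtain ⟨S, N, hN, rfl⟩ := exists_isGMatrixOf_of_mem_component markovMatrix_cyc123 hi hM
        exact ⟨S, N, hN, j, Or.inr (Or.inl rfl)⟩
      · obtain ⟨S, N, hN, rfl⟩ := exists_isGMatrixOf_of_mem_component markovMatrix_cyc132 hi hM
        exact ⟨S, N, hN, j, Or.inr (Or.inr rfl)⟩
  · rintro ⟨T, M, hM, j, h | h | h⟩
    · exact ⟨T.1, M, hM, j, h⟩
    · exact ⟨_, _, (isGMatrixOf_relabel_iff markovMatrix_cyc123 T.1 M).2 hM, j, h⟩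
    · exact ⟨_, _, (isGMatrixOf_relabel_iff markovMatrix_cyc132 T.1 M).2 hM, j, h⟩

theorem sum_eq_one_of_mem_gVectors {g : Fin 3 → ℤ} (hg : g ∈ gVectors markovMatrix) :
    g 0 + g 1 + g 2 = 1 := by
  obtain ⟨l, j, h⟩ := hg
  rw [hasDegree_seedAt_iff markovMatrix_skew] at h
  rw [← Fin.sum_univ_three, h, sum_deg_gData]

end Markov

open ClusterPattern Farey Markov in
theorem mainTheorem4 :
    -- every seed has a unique g-matrix, and each Farey triple is assigned exactly one
    (∀ l : List (Fin 3), ∃! M, IsGMatrixAt markovMatrix l M) ∧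
    (∀ T : FareyTriple, ∃! M, IsGMatrixOf T M) ∧
    -- the isomorphisms `φ` and `ψ` exist and are unique
    (∃! φ : exchangeGraph.induce (component 1) ≃g exchangeGraph.induce (component 2),
      IsLabelledIso cyc123 φ) ∧
    (∃! ψ : exchangeGraph.induce (component 1) ≃g exchangeGraph.induce (component 0),
      IsLabelledIso cyc132 ψ) ∧
    -- the g-matrices of `φ(T)` and `ψ(T)`
    (∀ φ : exchangeGraph.induce (component 1) ≃g exchangeGraph.induce (component 2),
      IsLabelledIso cyc123 φ → ∀ (T : component 1) (M : Matrix (Fin 3) (Fin 3) ℤ),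
        IsGMatrixOf T.1 M → IsGMatrixOf (φ T).1 (permAct cyc123 M)) ∧
    (∀ ψ : exchangeGraph.induce (component 1) ≃g exchangeGraph.induce (component 0),
      IsLabelledIso cyc132 ψ → ∀ (T : component 1) (M : Matrix (Fin 3) (Fin 3) ℤ),
        IsGMatrixOf T.1 M → IsGMatrixOf (ψ T).1 (permAct cyc132 M)) ∧
    -- this gives all g-vectors
    gVectors markovMatrix =
      {g | ∃ (T : component 1) (M : Matrix (Fin 3) (Fin 3) ℤ), IsGMatrixOf T.1 M ∧
        ∃ j, g = M.col j ∨ g = (permAct cyc123 M).col j ∨ g = (permAct cyc132 M).col j} ∧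
    -- and they lie in the plane `x + y + z = 1`
    ∀ g ∈ gVectors markovMatrix, g 0 + g 1 + g 2 = 1 := by
  have h2 : cyc123 1 = 2 := by decide
  have h0 : cyc132 1 = 0 := by decide
  refine ⟨fun l => ?_, fun T => ?_, existsUnique_isLabelledIso _ h2, existsUnique_isLabelledIso _ h0,
    fun φ hφ T M hM => ?_, fun ψ hψ T M hM => ?_, gVectors_markovMatrix,
    fun g hg => sum_eq_one_of_mem_gVectors hg⟩
  · simp only [isGMatrixAt_markovMatrix_iff]
    exact existsUnique_eq
  · obtain ⟨w, rfl⟩ := tripleAt_surjective T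
    simp only [isGMatrixOf_tripleAt_iff]
    exact existsUnique_eq
  · rw [hφ.eq_relabel h2]
    exact (isGMatrixOf_relabel_iff markovMatrix_cyc123 _ _).2 hM
  · rw [hψ.eq_relabel h0]
    exact (isGMatrixOf_relabel_iff markovMatrix_cyc132 _ _).2 hM
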